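/- Let $F$ be $\mathbb{C}$ or $\mathbb{H}$ (the quaternions), let $m,n\in\mathbb{N}$ and $\lambda\ge 0$. Every $Z\in F^{m\times n}$ has a singular value decomposition $Z=U\Sigma V^*$, where $U\in F^{m\times m}$ and $V\in F^{n\times n}$ are unitary and $\Sigma$ is an $m\times n$ real diagonal matrix whose diagonal entries are nonnegative and nonincreasing. For $X\in F^{m\times n}$ let $\sigma_1(X)\ge\sigma_2(X)\ge\dots\ge\sigma_{\min(m,n)}(X)\ge 0$ denote its singular values; if $F=\mathbb{H}$ and $X=A+B\jmath$ with complex matrices $A,B$, they are the singular values of the complex $2m\times 2n$ matrix $\begin{pmatrix}A&B\\-\overline{B}&\overline{A}\end{pmatrix}$, which occur in pairs, each pair being listed once. Let $\|X\|_*=\sum_i\sigma_i(X)$ be the trace norm. For $f:F^{p}\to\mathbb{R}$ and $\mathbf{z}\in F^p$ let $$\mathrm{prox}_f\,\mathbf{z}=\arg\min_{\mathbf{x}\in F^p}\Big(\tfrac12\|\mathbf{z}-\mathbf{x}\|_2^2+f(\mathbf{x})\Big).$$ Then for every $Z\in F^{m\times n}$ and every singular value decomposition $Z=U\Sigma V^*$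 as above, $\Sigma_{ii}=\sigma_i(Z)$ for all $i\le\min(m,n)$, and, identifying $F^{m\times n}$ with $F^{mn}$ by $\mathrm{vec}$, $$\mathrm{prox}_{\lambda\|\cdot\|_*}(\mathrm{vec}\,Z)=\mathrm{vec}\big(U(\Sigma-\lambda)_+V^*\big),$$ where $(\Sigma-\lambda)_+$ is the $m\times n$ diagonal matrix with diagonal entries $\max(\Sigma_{ii}-\lambda,0)$. That is, $U(\Sigma-\lambda)_+V^*$ is the unique minimizer over $X\in F^{m\times n}$ of $\tfrac12\|Z-X\|_F^2+\lambda\|X\|_*$. -/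

import Mathlib

open scoped Matrix

noncomputable section

namespace QuatPCP

/-- The (possibly rectangular) diagonal matrix with real diagonal entries `s`,
viewed as a matrix over `F`. -/
def rectDiag {m n : ℕ} (F : Type*) [Ring F] [Algebra ℝ F] (s : Fin (min m n) → ℝ) :
    Matrix (Fin m) (Fin n) F :=
  Matrix.of fun i j =>
    if h : (i : ℕ) = (j : ℕ) then
      algebraMap ℝ F (s ⟨(i : ℕ), lt_min i.isLt (h.trans_lt j.isLt)⟩)
    else 0

/-- `U * Σ * Vᴴ` is a singular value decomposition of `Z`, where `Σ = rectDiag F s`: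
`U` and `V` are unitary, and the diagonal entries of `Σ` are nonnegative and nonincreasing. -/
structure IsSVD {m n : ℕ} {F : Type*} [Ring F] [StarRing F] [Algebra ℝ F]
    (Z : Matrix (Fin m) (Fin n) F) (U : Matrix (Fin m) (Fin m) F)
    (s : Fin (min m n) → ℝ) (V : Matrix (Fin n) (Fin n) F) : Prop where
  unitary_left : U ∈ unitary (Matrix (Fin m) (Fin m) F)
  unitary_right : V ∈ unitary (Matrix (Fin n) (Fin n) F)
  nonneg : ∀ i, 0 ≤ s i
  antitone : Antitone s
  eq_mul : Z = U * rectDiag F s * Vᴴ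

/-- The complex representation `[[X, Y], [-conj Y, conj X]]` of a quaternionic matrix `X + Y j`,
where `X` and `Y` are complex matrices. -/
def complexRep {m n : ℕ} (A : Matrix (Fin m) (Fin n) (Quaternion ℝ)) :
    Matrix (Fin m ⊕ Fin m) (Fin n ⊕ Fin n) ℂ :=
  let X : Matrix (Fin m) (Fin n) ℂ := A.map fun q => ⟨q.re, q.imI⟩
  let Y : Matrix (Fin m) (Fin n) ℂ := A.map fun q => ⟨q.imJ, q.imK⟩
  Matrix.fromBlocks X Y (-(Y.map star)) (X.map star)

/-- The singular values of a complex matrix, in nonincreasing order. -/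
def singularValueC {m n : ℕ} (A : Matrix (Fin m) (Fin n) ℂ) (i : Fin (min m n)) : ℝ :=
  (Matrix.toEuclideanLin A).singularValues (i : ℕ)

/-- The singular values of a quaternionic matrix, in nonincreasing order: they are those of its
complex representation, where each of them occurs in a pair (at the positions `2 * i` and
`2 * i + 1`, counted from `0`). -/
def singularValueH {m n : ℕ} (A : Matrix (Fin m) (Fin n) (Quaternion ℝ))
    (i : Fin (min m n)) : ℝ :=
  (Matrix.toEuclideanLin (complexRep A)).singularValues (2 * (i : ℕ))

/-- The trace norm of a complex matrix. -/
def traceNormC {m n : ℕ} (A : Matrix (Fin m) (Fin n) ℂ) : ℝ :=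
  ∑ i, singularValueC A i

/-- The trace norm of a quaternionic matrix. -/
def traceNormH {m n : ℕ} (A : Matrix (Fin m) (Fin n) (Quaternion ℝ)) : ℝ :=
  ∑ i, singularValueH A i

/-- The vectorization of a matrix (columns stacked), as an element of `F ^ (m n)` with the
`2`-norm. -/
def vecL2 {m n : ℕ} {F : Type*} (A : Matrix (Fin m) (Fin n) F) :
    PiLp 2 (fun _ : Fin n × Fin m => F) :=
  WithLp.toLp 2 A.vec

/-- The matrix with a given vectorization. -/
def unvecL2 {m n : ℕ} {F : Type*} (x : PiLp 2 (fun _ : Fin n × Fin m => F)) :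
    Matrix (Fin m) (Fin n) F :=
  Matrix.of fun i j => x (j, i)

/-- The proximity operator of `f` at `z`: the set of all minimizers `x` of
`1/2 * ‖z - x‖₂ ^ 2 + f x`. -/
def prox {ι : Type*} [Fintype ι] {F : Type*} [NormedAddCommGroup F]
    (f : PiLp 2 (fun _ : ι => F) → ℝ) (z : PiLp 2 (fun _ : ι => F)) :
    Set (PiLp 2 (fun _ : ι => F)) :=
  {x | IsMinOn (fun y => (1 / 2 : ℝ) * ‖z - y‖ ^ 2 + f y) Set.univ x}

end QuatPCP

end

/-! Optimality of the thresholded matrix is a duality argument. Put `P = U (Σ - λ)₊ Vᴴ` and `D = Z -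
P`. The diagonal of `D` in the same bases is `min(s, λ)`, so `D` has spectral norm at most `λ`,
hence `⟨X, D⟩ ≤ λ‖X‖_*` for every `X`, with equality at `X = P`: `D` is a subgradient of `λ‖·‖_*` at
`P`. Expanding `‖Z - X‖² = ‖D - (X - P)‖²` shows that the objective at `X` exceeds that at `P` by at
least `½‖X - P‖²` (`IsSVD.objective_softThreshold_le`), which gives minimality and uniqueness
together. The trace norm enters only as the sum of the diagonal of an arbitrary decomposition, so
neither its convexity nor the triangle inequality is needed.

Existence of the decomposition is proved for `ℂ` and `ℍ` at once, without a spectral theorem. Fix a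
rectangular diagonal `C` with strictly decreasing positive entries and maximise `Re tr(Cᴴ U Z V)`
over the compact set of pairs of unitaries. First-order optimality makes `UZV` diagonal; testing
against phases and transpositions makes its diagonal nonnegative and nonincreasing
(`exists_rectDiag_of_maximal`). The only algebra required of the scalars is a tracial real part with
`star a * a = ‖a‖²`.

The diagonal is identified with the singular values through the characteristic polynomial of the
Gram matrix `Zᴴ Z`; quaternionic matrices are first carried to complex ones by the
star-multiplicative map `complexRep`, which doubles each diagonal entry. -/

namespace QuatPCP

/-- A star algebra over `ℝ` with a tracial real part, such as `ℂ` or the quaternions. -/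
class RealTracialAlgebra (F : Type*) [NormedRing F] [StarRing F] [NormedAlgebra ℝ F] where
  /-- The real part. -/
  re : F →ₗ[ℝ] ℝ
  re_one : re 1 = 1
  re_mul_comm : ∀ a b, re (a * b) = re (b * a)
  re_star : ∀ a, re (star a) = re a
  star_mul_self : ∀ a : F, star a * a = algebraMap ℝ F (‖a‖ ^ 2)

open RealTracialAlgebra

theorem star_algebraMap_real {F : Type*} [NormedRing F] [StarRing F] [NormedAlgebra ℝ F]
    [StarModule ℝ F] (r : ℝ) : star (algebraMap ℝ F r) = algebraMap ℝ F r := by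
  rw [← algebraMap_star_comm, star_trivial]

/-! ### Tracial real part and the real Frobenius pairing. -/

section Tracial

variable {F : Type*} [NormedRing F] [StarRing F] [NormedAlgebra ℝ F]
  [RealTracialAlgebra F] {m n : ℕ}

theorem re_algebraMap (r : ℝ) : re (algebraMap ℝ F r) = r := by
  rw [Algebra.algebraMap_eq_smul_one, map_smul, re_one, smul_eq_mul, mul_one]

theorem re_algebraMap_mul (r : ℝ) (a : F) : re (algebraMap ℝ F r * a) = r * re a := by
  rw [← Algebra.smul_def, map_smul, smul_eq_mul]

theorem re_star_mul_self (a : F) : re (star a * a) = ‖a‖ ^ 2 := by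
  rw [star_mul_self, re_algebraMap]

/-- Stands in for Cauchy–Schwarz against `1`: `r = re a` yields `|re a| ≤ ‖a‖`, and `r = ‖a‖` yields
the equality case. -/
theorem norm_sub_algebraMap_sq [StarModule ℝ F] (a : F) (r : ℝ) :
    ‖a - algebraMap ℝ F r‖ ^ 2 = ‖a‖ ^ 2 - 2 * r * re a + r ^ 2 := by
  rw [← re_star_mul_self, star_sub, star_algebraMap_real, sub_mul, mul_sub, mul_sub,
    map_sub, map_sub, map_sub, re_star_mul_self,
    re_algebraMap_mul, re_algebraMap_mul, re_algebraMap, re_mul_comm, re_algebraMap_mul, re_star]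
  ring

theorem abs_re_le_norm [StarModule ℝ F] (a : F) : |re a| ≤ ‖a‖ := by
  refine abs_le_of_sq_le_sq ?_ (norm_nonneg a)
  nlinarith [norm_sub_algebraMap_sq a (re a), sq_nonneg ‖a - algebraMap ℝ F (re a)‖]

theorem eq_algebraMap_norm_of_norm_le_re [StarModule ℝ F] {a : F} (h : ‖a‖ ≤ re a) :
    a = algebraMap ℝ F ‖a‖ := by
  have h' : re a = ‖a‖ := le_antisymm ((le_abs_self _).trans (abs_re_le_norm a)) h
  have := norm_sub_algebraMap_sq a ‖a‖
  rw [h'] at this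
  have h0 : ‖a - algebraMap ℝ F ‖a‖‖ ^ 2 = 0 := by rw [this]; ring
  exact sub_eq_zero.1 (norm_eq_zero.1 (pow_eq_zero_iff (two_ne_zero) |>.1 h0))

/-- The real part of the trace. -/
noncomputable def reTrace (A : Matrix (Fin n) (Fin n) F) : ℝ := re A.trace

theorem reTrace_eq_sum (A : Matrix (Fin n) (Fin n) F) : reTrace A = ∑ i, re (A i i) := by
  simp [reTrace, Matrix.trace, map_sum]

theorem reTrace_add (A B : Matrix (Fin n) (Fin n) F) :
    reTrace (A + B) = reTrace A + reTrace B := by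
  simp [reTrace]

theorem reTrace_sub (A B : Matrix (Fin n) (Fin n) F) :
    reTrace (A - B) = reTrace A - reTrace B := by
  simp [reTrace]

theorem reTrace_smul (r : ℝ) (A : Matrix (Fin n) (Fin n) F) :
    reTrace (r • A) = r * reTrace A := by
  simp [reTrace]

theorem reTrace_conjTranspose (A : Matrix (Fin n) (Fin n) F) : reTrace Aᴴ = reTrace A := by
  simp [reTrace_eq_sum, re_star]

theorem reTrace_mul_comm (A : Matrix (Fin m) (Fin n) F) (B : Matrix (Fin n) (Fin m) F) :
    reTrace (A * B) = reTrace (B * A) := by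
  simp only [reTrace_eq_sum, Matrix.mul_apply, map_sum]
  rw [Finset.sum_comm]
  simp only [re_mul_comm]

theorem reTrace_conjTranspose_mul_self (A : Matrix (Fin m) (Fin n) F) :
    reTrace (Aᴴ * A) = ∑ j, ∑ i, ‖A i j‖ ^ 2 := by
  simp [reTrace_eq_sum, Matrix.mul_apply, map_sum, re_star_mul_self]

theorem eq_zero_of_reTrace_conjTranspose_mul_self {A : Matrix (Fin m) (Fin n) F}
    (h : reTrace (Aᴴ * A) = 0) : A = 0 := by
  rw [reTrace_conjTranspose_mul_self] at h
  ext i j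
  rw [Finset.sum_eq_zero_iff_of_nonneg fun _ _ => by positivity] at h
  have := h j (Finset.mem_univ _)
  rw [Finset.sum_eq_zero_iff_of_nonneg fun _ _ => by positivity] at this
  simpa using this i (Finset.mem_univ _)

/-- A square matrix orthogonal to all skew-Hermitian matrices is Hermitian. -/
theorem conjTranspose_eq_self_of_reTrace_mul_skew {N : Matrix (Fin n) (Fin n) F}
    (h : ∀ K : Matrix (Fin n) (Fin n) F, Kᴴ = -K → reTrace (N * K) = 0) : Nᴴ = N := by
  -- The test matrix is twice the skew part of `N`. It is orthogonal to `N`, and by conjugation to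
  -- `Nᴴ`, hence to itself.
  have hK : (N - Nᴴ)ᴴ = -(N - Nᴴ) := by simp
  have h1 := h _ hK
  have h2 : reTrace (Nᴴ * (N - Nᴴ)) = 0 := by
    rw [← reTrace_conjTranspose, Matrix.conjTranspose_mul, hK, Matrix.conjTranspose_conjTranspose,
      reTrace_mul_comm, mul_neg]
    have := reTrace_sub (0 : Matrix (Fin n) (Fin n) F) (N * (N - Nᴴ))
    rw [zero_sub, h1] at this
    simpa [reTrace] using this
  have h3 : reTrace ((N - Nᴴ)ᴴ * (N - Nᴴ)) = 0 := by
    rw [Matrix.conjTranspose_sub, Matrix.conjTranspose_conjTranspose, sub_mul, reTrace_sub, h1, h2,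
      sub_zero]
  exact (sub_eq_zero.1 (eq_zero_of_reTrace_conjTranspose_mul_self h3)).symm

theorem sum_norm_sq_col_of_mem_unitary {U : Matrix (Fin n) (Fin n) F}
    (hU : U ∈ unitary (Matrix (Fin n) (Fin n) F)) (j : Fin n) : ∑ i, ‖U i j‖ ^ 2 = 1 := by
  have h := congrArg (fun M : Matrix (Fin n) (Fin n) F => re (M j j))
    (Unitary.star_mul_self_of_mem hU)
  simpa [Matrix.mul_apply, Matrix.star_apply, map_sum, re_star_mul_self, re_one] using h

theorem norm_star_eq (a : F) : ‖star a‖ = ‖a‖ := by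
  have h : ‖star a‖ ^ 2 = ‖a‖ ^ 2 := by
    rw [← re_star_mul_self, ← re_star_mul_self, star_star, re_mul_comm]
  exact (sq_eq_sq₀ (norm_nonneg _) (norm_nonneg _)).1 h

theorem sum_norm_sq_row_of_mem_unitary {U : Matrix (Fin n) (Fin n) F}
    (hU : U ∈ unitary (Matrix (Fin n) (Fin n) F)) (i : Fin n) : ∑ j, ‖U i j‖ ^ 2 = 1 := by
  have h := sum_norm_sq_col_of_mem_unitary (Unitary.star_mem hU) i
  simpa [Matrix.star_apply, norm_star_eq] using h

end Tracial

/-! ### Rectangular real diagonal matrices. -/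

section RectDiag

variable {m n : ℕ}

/-- The row of the `k`-th diagonal entry. -/
def diagRow (k : Fin (min m n)) : Fin m := Fin.castLE (min_le_left m n) k

/-- The column of the `k`-th diagonal entry. -/
def diagCol (k : Fin (min m n)) : Fin n := Fin.castLE (min_le_right m n) k

/-- Extension by zero of a sequence of diagonal entries. -/
noncomputable def extendZero {r : ℕ} (s : Fin r → ℝ) (i : ℕ) : ℝ :=
  if h : i < r then s ⟨i, h⟩ else 0

theorem rectDiag_apply_diag {F : Type*} [Ring F] [Algebra ℝ F] (s : Fin (min m n) → ℝ)
    (k : Fin (min m n)) : rectDiag F s (diagRow k) (diagCol k) = algebraMap ℝ F (s k) := by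
  simp [rectDiag, diagRow, diagCol]

theorem rectDiag_apply_of_ne {F : Type*} [Ring F] [Algebra ℝ F] (s : Fin (min m n) → ℝ)
    {i : Fin m} {j : Fin n} (h : (i : ℕ) ≠ j) : rectDiag F s i j = 0 := by
  simp [rectDiag, h]

theorem rectDiag_apply {F : Type*} [Ring F] [Algebra ℝ F] (s : Fin (min m n) → ℝ)
    (i : Fin m) (j : Fin n) :
    rectDiag F s i j = if (i : ℕ) = j then algebraMap ℝ F (extendZero s i) else 0 := by
  by_cases h : (i : ℕ) = j
  · have : (i : ℕ) < min m n := lt_min i.isLt (h.trans_lt j.isLt)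
    simp [rectDiag, extendZero, h, h ▸ this]
  · simp [rectDiag, h]

theorem eq_rectDiag {F : Type*} [Ring F] [Algebra ℝ F] {M : Matrix (Fin m) (Fin n) F}
    {s : Fin (min m n) → ℝ} (h₀ : ∀ (i : Fin m) (j : Fin n), (i : ℕ) ≠ j → M i j = 0)
    (h₁ : ∀ k, M (diagRow k) (diagCol k) = algebraMap ℝ F (s k)) : M = rectDiag F s := by
  ext i j
  by_cases h : (i : ℕ) = j
  · have hk : (i : ℕ) < min m n := lt_min i.isLt (h.trans_lt j.isLt)
    have hi : i = diagRow (n := n) ⟨i, hk⟩ := rfl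
    have hj : j = diagCol (m := m) ⟨i, hk⟩ := Fin.ext h.symm
    rw [hi, hj, h₁, rectDiag_apply_diag]
  · rw [h₀ i j h, rectDiag_apply_of_ne s h]

theorem rectDiag_eq_sum_single {F : Type*} [Ring F] [Algebra ℝ F] (s : Fin (min m n) → ℝ) :
    rectDiag F s = ∑ k, Matrix.single (diagRow k) (diagCol k) (algebraMap ℝ F (s k)) := by
  symm
  apply eq_rectDiag
  · intro i j h
    rw [Matrix.sum_apply]
    refine Finset.sum_eq_zero fun k _ => Matrix.single_apply_of_ne _ _ _ _ _ ?_
    rintro ⟨rfl, rfl⟩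
    exact h rfl
  · intro k
    rw [Matrix.sum_apply, Finset.sum_eq_single k]
    · simp
    · intro l _ hl
      refine Matrix.single_apply_of_ne _ _ _ _ _ ?_
      rintro ⟨h, -⟩
      exact hl (Fin.ext (congrArg (fun x : Fin m => (x : ℕ)) h))
    · simp

theorem mul_rectDiag_mul_apply {F : Type*} [Ring F] [Algebra ℝ F] (s : Fin (min m n) → ℝ)
    (A : Matrix (Fin m) (Fin m) F) (B : Matrix (Fin n) (Fin n) F) (i : Fin m) (j : Fin n) :
    (A * rectDiag F s * B) i j = ∑ k, s k • (A i (diagRow k) * B (diagCol k) j) := by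
  rw [rectDiag_eq_sum_single, Matrix.mul_sum, Matrix.sum_mul, Matrix.sum_apply]
  refine Finset.sum_congr rfl fun k _ => ?_
  rw [Matrix.mul_apply, Finset.sum_eq_single (diagCol k)]
  · rw [Matrix.mul_single_apply_same, ← Algebra.commutes, mul_assoc, Algebra.smul_def]
  · intro l _ hl
    rw [Matrix.mul_single_apply_of_ne _ _ _ _ _ hl, zero_mul]
  · simp

variable {F : Type*} [NormedRing F] [StarRing F] [NormedAlgebra ℝ F] [StarModule ℝ F]

/-- Padding by zeros lets one sequence on `ℕ` describe both Gram matrices, although their sizes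
differ. -/
theorem conjTranspose_rectDiag_mul_rectDiag (s : Fin (min m n) → ℝ) :
    (rectDiag F s)ᴴ * rectDiag F s =
      Matrix.diagonal fun j : Fin n => algebraMap ℝ F (extendZero s j ^ 2) := by
  ext j j'
  rw [Matrix.mul_apply, Matrix.diagonal_apply]
  simp only [Matrix.conjTranspose_apply, rectDiag_apply]
  split_ifs with h
  · subst h
    by_cases hj : (j : ℕ) < m
    · rw [Finset.sum_eq_single ⟨j, hj⟩]
      · simp [star_algebraMap_real, sq]
      · intro i _ hi
        have : (i : ℕ) ≠ j := fun h => hi (Fin.ext h)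
        simp [this]
      · simp
    · have : extendZero s j = 0 := by
        rw [extendZero, dif_neg]
        exact fun h => hj (h.trans_le (min_le_left _ _))
      rw [this]
      simp only [ne_eq, OfNat.ofNat_ne_zero, not_false_eq_true, zero_pow, map_zero]
      refine Finset.sum_eq_zero fun i _ => ?_
      have : (i : ℕ) ≠ j := fun h => hj (h ▸ i.isLt)
      simp [this]
  · refine Finset.sum_eq_zero fun i _ => ?_
    by_cases h1 : (i : ℕ) = j
    · have : (i : ℕ) ≠ j' := fun h2 => h (Fin.ext (h1.symm.trans h2))
      simp [this]
    · simp [h1]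

theorem rectDiag_mul_conjTranspose_rectDiag (s : Fin (min m n) → ℝ) :
    rectDiag F s * (rectDiag F s)ᴴ =
      Matrix.diagonal fun j : Fin m => algebraMap ℝ F (extendZero s j ^ 2) := by
  ext j j'
  rw [Matrix.mul_apply, Matrix.diagonal_apply]
  simp only [Matrix.conjTranspose_apply, rectDiag_apply]
  split_ifs with h
  · subst h
    by_cases hj : (j : ℕ) < n
    · rw [Finset.sum_eq_single ⟨j, hj⟩]
      · simp [star_algebraMap_real, sq]
      · intro i _ hi
        have : (j : ℕ) ≠ i := fun h => hi (Fin.ext h.symm)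
        simp [this]
      · simp
    · have : extendZero s j = 0 := by
        rw [extendZero, dif_neg]
        exact fun h => hj (h.trans_le (min_le_right _ _))
      rw [this]
      simp
  · refine Finset.sum_eq_zero fun i _ => ?_
    by_cases h1 : (j : ℕ) = i
    · have : (j' : ℕ) ≠ i := fun h2 => h (Fin.ext (h1.trans h2.symm))
      simp [this]
    · simp [h1]

variable [RealTracialAlgebra F]

theorem reTrace_conjTranspose_rectDiag_mul (s : Fin (min m n) → ℝ)
    (Y : Matrix (Fin m) (Fin n) F) :
    reTrace ((rectDiag F s)ᴴ * Y) = ∑ k, s k * re (Y (diagRow k) (diagCol k)) := by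
  rw [rectDiag_eq_sum_single, Matrix.conjTranspose_sum, Matrix.sum_mul, reTrace, Matrix.trace_sum,
    map_sum]
  refine Finset.sum_congr rfl fun k _ => ?_
  rw [Matrix.conjTranspose_single, Matrix.trace_single_mul, star_algebraMap_real,
    smul_eq_mul, re_algebraMap_mul]

end RectDiag

/-! ### Optimisation over the unitary group and existence of the decomposition. -/

theorem continuous_re {F : Type*} [NormedRing F] [StarRing F] [NormedAlgebra ℝ F]
    [FiniteDimensional ℝ F] [RealTracialAlgebra F] : Continuous (re : F → ℝ) :=
  LinearMap.continuous_of_finiteDimensional _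

theorem normedStarGroup_of_realTracialAlgebra {F : Type*} [NormedRing F] [StarRing F]
    [NormedAlgebra ℝ F] [RealTracialAlgebra F] : NormedStarGroup F :=
  ⟨fun a => (norm_star_eq a).le⟩

theorem permMatrix_mem_unitary {F : Type*} [Ring F] [StarRing F] {n : ℕ}
    (σ : Equiv.Perm (Fin n)) :
    σ.permMatrix F ∈ unitary (Matrix (Fin n) (Fin n) F) := by
  rw [Unitary.mem_iff, Matrix.star_eq_conjTranspose, Matrix.conjTranspose_permMatrix,
    ← Matrix.permMatrix_mul, ← Matrix.permMatrix_mul]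
  simp

theorem diagonal_mem_unitary {F : Type*} [Ring F] [StarRing F] {n : ℕ} {d : Fin n → F}
    (h₁ : ∀ i, star (d i) * d i = 1)
    (h₂ : ∀ i, d i * star (d i) = 1) :
    Matrix.diagonal d ∈ unitary (Matrix (Fin n) (Fin n) F) := by
  rw [Unitary.mem_iff, Matrix.star_eq_conjTranspose, Matrix.diagonal_conjTranspose,
    Matrix.diagonal_mul_diagonal, Matrix.diagonal_mul_diagonal]
  simp [h₁, h₂]

/-- A functional maximised over the unitary group at `1` vanishes on skew-adjoint elements. -/
theorem map_skewAdjoint_eq_zero_of_le_map_one {A : Type*} [NormedRing A] [NormedAlgebra ℝ A]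
    [CompleteSpace A] [StarRing A] [StarModule ℝ A] [ContinuousStar A] (L : A →L[ℝ] ℝ)
    (h : ∀ u ∈ unitary A, L u ≤ L 1) {x : A} (hx : star x = -x) : L x = 0 := by
  let : NormedAlgebra ℚ A := NormedAlgebra.restrictScalars ℚ ℝ A
  -- `exp (t x)` is a curve of unitaries through `1` with velocity `x`, so `L` along it has a
  -- maximum at `t = 0`.
  have hexp : HasDerivAt (fun t : ℝ => NormedSpace.exp (t • x)) x 0 := by
    simpa using hasDerivAt_exp_smul_const (𝕂 := ℝ) x 0
  have hd := L.hasFDerivAt.comp_hasDerivAt (0 : ℝ) hexp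
  refine IsLocalMax.hasDerivAt_eq_zero (Filter.Eventually.of_forall fun t => ?_) hd
  simp only [Function.comp_apply, zero_smul, NormedSpace.exp_zero]
  refine h _ (NormedSpace.exp_mem_unitary_of_mem_skewAdjoint ?_)
  rw [skewAdjoint.mem_iff, star_smul, hx, star_trivial, smul_neg]

section Existence

variable {F : Type*} [NormedRing F] [StarRing F] [NormedAlgebra ℝ F] [StarModule ℝ F]
  [FiniteDimensional ℝ F] [RealTracialAlgebra F] {m n : ℕ}

/-- Each row of a unitary matrix has norm one, so its entries lie in the closed unit ball of a
finite-dimensional space. -/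
theorem isCompact_unitary_matrix {F : Type*} [NormedRing F] [StarRing F] [NormedAlgebra ℝ F]
    [FiniteDimensional ℝ F] [RealTracialAlgebra F] {n : ℕ} :
    IsCompact (unitary (Matrix (Fin n) (Fin n) F) : Set (Matrix (Fin n) (Fin n) F)) := by
  have : NormedStarGroup F := normedStarGroup_of_realTracialAlgebra
  have : ProperSpace F := FiniteDimensional.proper ℝ F
  refine IsCompact.of_isClosed_subset
    (isCompact_univ_pi fun _ => isCompact_univ_pi fun _ => isCompact_closedBall (0 : F) 1)
    isClosed_unitary ?_
  intro U hU i _ j _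
  rw [mem_closedBall_zero_iff]
  have h := sum_norm_sq_row_of_mem_unitary hU i
  have h' : ‖U i j‖ ^ 2 ≤ 1 := by
    rw [← h]
    exact Finset.single_le_sum (f := fun j => ‖U i j‖ ^ 2) (fun _ _ => by positivity)
      (Finset.mem_univ j)
  exact (sq_le_one_iff₀ (norm_nonneg _)).1 h'

section Exponential

-- The norm serves only to make the exponential available; `star` need only be continuous for it.
attribute [local instance] Matrix.linftyOpNormedRing Matrix.linftyOpNormedAlgebra

/-- A square matrix whose real trace does not grow under unitary multiplication is Hermitian. -/
theorem conjTranspose_eq_self_of_reTrace_mul_unitary_le {N : Matrix (Fin n) (Fin n) F}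
    (h : ∀ A ∈ unitary (Matrix (Fin n) (Fin n) F), reTrace (N * A) ≤ reTrace N) : Nᴴ = N := by
  have : NormedStarGroup F := normedStarGroup_of_realTracialAlgebra
  refine conjTranspose_eq_self_of_reTrace_mul_skew fun K hK => ?_
  let L : Matrix (Fin n) (Fin n) F →ₗ[ℝ] ℝ :=
    { toFun := fun X => reTrace (N * X)
      map_add' := fun X Y => by rw [mul_add, reTrace_add]
      map_smul' := fun r X => by
        rw [Matrix.mul_smul, reTrace_smul, RingHom.id_apply, smul_eq_mul] }
  have hstar : ContinuousStar (Matrix (Fin n) (Fin n) F) := inferInstance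
  have hfin : FiniteDimensional ℝ (Matrix (Fin n) (Fin n) F) := inferInstance
  have hcomplete := @FiniteDimensional.complete ℝ (Matrix (Fin n) (Fin n) F) _ _ _ _ _ _ _ _ hfin
  refine @map_skewAdjoint_eq_zero_of_le_map_one _ _ _ hcomplete _ _ hstar
    ⟨L, LinearMap.continuous_of_finiteDimensional L⟩ (fun u hu => ?_) K hK
  change reTrace (N * u) ≤ reTrace (N * 1)
  rw [mul_one]
  exact h u hu

end Exponential

/-- The smaller of two distinct indices `i < m`, `j < n` is below `min m n`, so its entry is
positive and strictly exceeds the other, even when the other is padding. -/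
theorem extendZero_sq_ne {c : Fin (min m n) → ℝ} (hc : StrictAnti c) (hpos : ∀ k, 0 < c k)
    (i : Fin m) (j : Fin n) (hij : (i : ℕ) ≠ j) : extendZero c i ^ 2 ≠ extendZero c j ^ 2 := by
  have key : ∀ a b : ℕ, a < b → a < min m n → extendZero c b ^ 2 < extendZero c a ^ 2 := by
    intro a b hab ha
    have hb0 : 0 ≤ extendZero c b := by
      unfold extendZero
      split_ifs
      exacts [(hpos _).le, le_rfl]
    have hlt : extendZero c b < extendZero c a := by
      unfold extendZero
      rw [dif_pos ha]
      split_ifs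
      exacts [hc (by exact hab), hpos _]
    exact pow_lt_pow_left₀ hlt hb0 two_ne_zero
  rcases lt_or_gt_of_ne hij with h | h
  · exact (key _ _ h (lt_min i.isLt (h.trans j.isLt))).ne'
  · exact (key _ _ h (lt_min (h.trans i.isLt) j.isLt)).ne

/-- The pairing with a diagonal matrix with decreasing positive entries is maximal on a unitary
orbit only at a diagonal matrix with nonnegative nonincreasing entries. -/
theorem exists_rectDiag_of_maximal {c : Fin (min m n) → ℝ} (hc : StrictAnti c)
    (hpos : ∀ k, 0 < c k) {M : Matrix (Fin m) (Fin n) F}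
    (hM : ∀ A ∈ unitary (Matrix (Fin m) (Fin m) F), ∀ B ∈ unitary (Matrix (Fin n) (Fin n) F),
      reTrace ((rectDiag F c)ᴴ * (A * M * B)) ≤ reTrace ((rectDiag F c)ᴴ * M)) :
    ∃ s : Fin (min m n) → ℝ, (∀ k, 0 ≤ s k) ∧ Antitone s ∧ M = rectDiag F s := by
  set C := rectDiag F c with hC
  have h₁ : (M * Cᴴ)ᴴ = M * Cᴴ := by
    refine conjTranspose_eq_self_of_reTrace_mul_unitary_le fun A hA => ?_
    have := hM A hA 1 (one_mem _)
    rwa [Matrix.mul_one, ← reTrace_mul_comm, Matrix.mul_assoc, reTrace_mul_comm,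
      ← reTrace_mul_comm M] at this
  have h₂ : (Cᴴ * M)ᴴ = Cᴴ * M := by
    refine conjTranspose_eq_self_of_reTrace_mul_unitary_le fun B hB => ?_
    have := hM 1 (one_mem _) B hB
    rwa [Matrix.one_mul, ← Matrix.mul_assoc] at this
  rw [Matrix.conjTranspose_mul, Matrix.conjTranspose_conjTranspose] at h₁ h₂
  -- Hermitian symmetry on both sides gives `C Cᴴ M = C Mᴴ C = M Cᴴ C`. Entrywise this is `c_i² M_ij
  -- = c_j² M_ij`, which kills the off-diagonal entries.
  have h₃ : (C * Cᴴ) * M = M * (Cᴴ * C) := by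
    rw [Matrix.mul_assoc, ← h₂, ← Matrix.mul_assoc, h₁, Matrix.mul_assoc]
  rw [hC, rectDiag_mul_conjTranspose_rectDiag, conjTranspose_rectDiag_mul_rectDiag] at h₃
  have hoff : ∀ (i : Fin m) (j : Fin n), (i : ℕ) ≠ j → M i j = 0 := by
    intro i j hij
    have h := congrFun (congrFun h₃ i) j
    rw [Matrix.diagonal_mul, Matrix.mul_diagonal, ← Algebra.commutes, ← sub_eq_zero, ← sub_mul,
      ← map_sub, ← Algebra.smul_def] at h
    exact (smul_eq_zero.1 h).resolve_left (sub_ne_zero.2 (extendZero_sq_ne hc hpos i j hij))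
  have hdiag : ∀ k, M (diagRow k) (diagCol k) = algebraMap ℝ F ‖M (diagRow k) (diagCol k)‖ := by
    intro k
    apply eq_algebraMap_norm_of_norm_le_re
    set a := M (diagRow k) (diagCol k) with ha
    by_cases ha0 : a = 0
    · simp [ha0]
    have hn : ‖a‖ ≠ 0 := norm_ne_zero_iff.2 ha0
    -- This phase rotates `a` to `u * a = ‖a‖`. Applied to row `k` alone it changes the pairing by
    -- `c k * (‖a‖ - re a)`, which maximality makes nonpositive.
    set u : F := ‖a‖⁻¹ • star a with hu
    have hu₁ : star u * u = 1 := by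
      rw [star_mul_self, hu, norm_smul, norm_star_eq, norm_inv, norm_norm, inv_mul_cancel₀ hn,
        one_pow, map_one]
    have hu₂ : u * star u = 1 := by
      have := star_mul_self (star u)
      rw [star_star, norm_star_eq] at this
      rw [this, ← star_mul_self, hu₁]
    have hA : Matrix.diagonal (Function.update (fun _ : Fin m => (1 : F)) (diagRow k) u) ∈
        unitary (Matrix (Fin m) (Fin m) F) := by
      apply diagonal_mem_unitary <;> intro i <;>
        rcases eq_or_ne i (diagRow k) with rfl | hi <;>
        simp_all only [Function.update_self, Function.update_of_ne, ne_eq,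
          not_false_eq_true, star_one, mul_one]
    have h := hM _ hA 1 (one_mem _)
    rw [Matrix.mul_one, reTrace_conjTranspose_rectDiag_mul, reTrace_conjTranspose_rectDiag_mul,
      ← sub_nonpos, ← Finset.sum_sub_distrib, Finset.sum_eq_single k] at h
    · rw [Matrix.diagonal_mul, Function.update_self, ← ha, ← mul_sub] at h
      have h' := nonpos_of_mul_nonpos_right h (hpos k)
      rw [hu, smul_mul_assoc, map_smul, re_star_mul_self, smul_eq_mul, sq, ← mul_assoc,
        inv_mul_cancel₀ hn, one_mul] at h'
      linarith
    · intro l _ hl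
      have : (diagRow l : Fin m) ≠ diagRow k := fun h =>
        hl (Fin.ext (congrArg (fun x : Fin m => (x : ℕ)) h))
      rw [Matrix.diagonal_mul, Function.update_of_ne this, one_mul, sub_self]
    · simp
  refine ⟨fun k => ‖M (diagRow k) (diagCol k)‖, fun _ => norm_nonneg _, ?_, eq_rectDiag hoff hdiag⟩
  set d : Fin (min m n) → ℝ := fun k => ‖M (diagRow k) (diagCol k)‖ with hd
  have hre : ∀ k, re (M (diagRow k) (diagCol k)) = d k := fun k => by
    rw [hdiag k, re_algebraMap]
  intro a b hab
  rcases hab.eq_or_lt with rfl | hab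
  · exact le_rfl
  -- Rearrangement: swapping rows and columns together exchanges two diagonal entries, so maximality
  -- says `(c a - c b) * (d b - d a) ≤ 0`.
  have h := hM _ (permMatrix_mem_unitary (Equiv.swap (diagRow a) (diagRow b))) _
    (permMatrix_mem_unitary (Equiv.swap (diagCol a) (diagCol b)))
  rw [Equiv.Perm.permMatrix, Equiv.Perm.permMatrix, PEquiv.toMatrix_toPEquiv_mul,
    PEquiv.mul_toMatrix_toPEquiv, reTrace_conjTranspose_rectDiag_mul,
    reTrace_conjTranspose_rectDiag_mul, ← sub_nonpos, ← Finset.sum_sub_distrib,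
    Finset.sum_eq_add a b hab.ne] at h
  · simp only [Matrix.submatrix_apply, id, Equiv.symm_swap, Equiv.swap_apply_left,
      Equiv.swap_apply_right, hre] at h
    have := hc hab
    by_contra! hlt
    nlinarith
  · rintro l - ⟨hla, hlb⟩
    have hr : ∀ x, l ≠ x → (diagRow l : Fin m) ≠ diagRow x := fun x hx h =>
      hx (Fin.ext (congrArg (fun x : Fin m => (x : ℕ)) h))
    have hcol : ∀ x, l ≠ x → (diagCol l : Fin n) ≠ diagCol x := fun x hx h =>
      hx (Fin.ext (congrArg (fun x : Fin n => (x : ℕ)) h))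
    simp only [Matrix.submatrix_apply, id, Equiv.symm_swap]
    rw [Equiv.swap_apply_of_ne_of_ne (hr a hla) (hr b hlb),
      Equiv.swap_apply_of_ne_of_ne (hcol a hla) (hcol b hlb), sub_self]
  · simp
  · simp

/-- Existence of the singular value decomposition. -/
theorem exists_isSVD (Z : Matrix (Fin m) (Fin n) F) : ∃ U s V, IsSVD Z U s V := by
  have : NormedStarGroup F := normedStarGroup_of_realTracialAlgebra
  -- Any strictly decreasing positive sequence would do; this one is positive because `k < min m n ≤
  -- m`.
  let c : Fin (min m n) → ℝ := fun k => m - k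
  have hc : StrictAnti c := fun a b hab => by
    have : ((a : ℕ) : ℝ) < (b : ℕ) := by exact_mod_cast hab
    simp only [c]
    linarith
  have hpos : ∀ k, 0 < c k := fun k => by
    have : ((k : ℕ) : ℝ) < m := by exact_mod_cast k.isLt.trans_le (min_le_left m n)
    simp only [c]
    linarith
  have hcont : Continuous fun p : Matrix (Fin m) (Fin m) F × Matrix (Fin n) (Fin n) F =>
      reTrace ((rectDiag F c)ᴴ * (p.1 * Z * p.2)) := by
    refine continuous_re.comp (Continuous.matrix_trace ?_)
    exact continuous_const.matrix_mul
      ((continuous_fst.matrix_mul continuous_const).matrix_mul continuous_snd)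
  obtain ⟨⟨U, V⟩, ⟨hU, hV⟩, hmax⟩ := (isCompact_unitary_matrix (F := F) (n := m)).prod
    (isCompact_unitary_matrix (F := F) (n := n)) |>.exists_isMaxOn
    ⟨(1, 1), one_mem _, one_mem _⟩ hcont.continuousOn
  obtain ⟨s, hs0, hs, hM⟩ := exists_rectDiag_of_maximal (F := F) hc hpos (M := U * Z * V) (by
    intro A hA B hB
    have := hmax (a := (A * U, V * B)) ⟨mul_mem hA hU, mul_mem hV hB⟩
    simpa only [Set.mem_ofPred_eq, Matrix.mul_assoc] using this)
  refine ⟨star U, s, V, Unitary.star_mem hU, hV, hs0, hs, ?_⟩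
  rw [← hM, ← Matrix.star_eq_conjTranspose V, ← Matrix.mul_assoc, ← Matrix.mul_assoc,
    Unitary.star_mul_self_of_mem hU, Matrix.one_mul, Matrix.mul_assoc,
    Unitary.mul_star_self_of_mem hV, Matrix.mul_one]

end Existence

/-! ### Soft thresholding as a proximity operator. -/

theorem norm_vecL2_sq {F : Type*} [NormedRing F] [StarRing F] [NormedAlgebra ℝ F]
    [RealTracialAlgebra F] {m n : ℕ} (A : Matrix (Fin m) (Fin n) F) : ‖vecL2 A‖ ^ 2 = reTrace (Aᴴ * A) := by
  rw [PiLp.norm_sq_eq_of_L2, reTrace_conjTranspose_mul_self, Fintype.sum_prod_type]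
  rfl

theorem rectDiag_sub {F : Type*} [Ring F] [Algebra ℝ F] {m n : ℕ} (s t : Fin (min m n) → ℝ) :
    rectDiag F (fun k => s k - t k) = (rectDiag F s - rectDiag F t : Matrix (Fin m) (Fin n) F) := by
  ext i j
  by_cases h : (i : ℕ) = j <;> simp [rectDiag, h]

theorem IsSVD.softThreshold {F : Type*} [Ring F] [StarRing F] [Algebra ℝ F] {m n : ℕ}
    {lam : ℝ} {Z : Matrix (Fin m) (Fin n) F}
    {U : Matrix (Fin m) (Fin m) F} {V : Matrix (Fin n) (Fin n) F} {s : Fin (min m n) → ℝ}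
    (hZ : IsSVD Z U s V) :
    IsSVD (U * rectDiag F (fun i => max (s i - lam) 0) * Vᴴ) U (fun i => max (s i - lam) 0) V where
  unitary_left := hZ.unitary_left
  unitary_right := hZ.unitary_right
  nonneg _ := le_max_right _ _
  antitone _ _ h := max_le_max (sub_le_sub_right (hZ.antitone h) _) le_rfl
  eq_mul := rfl

section Prox

variable {F : Type*} [NormedRing F] [StarRing F] [NormedAlgebra ℝ F] [StarModule ℝ F]
  [RealTracialAlgebra F] {m n : ℕ}

/-- A weak form of von Neumann's trace inequality: the duality between the trace norm and the
spectral norm. -/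
theorem reTrace_conjTranspose_mul_le {lam : ℝ} {X Z : Matrix (Fin m) (Fin n) F}
    {U U' : Matrix (Fin m) (Fin m) F} {V V' : Matrix (Fin n) (Fin n) F}
    {s d : Fin (min m n) → ℝ} (hX : IsSVD X U s V)
    (hU' : U' ∈ unitary (Matrix (Fin m) (Fin m) F)) (hV' : V' ∈ unitary (Matrix (Fin n) (Fin n) F))
    (hd₀ : ∀ k, 0 ≤ d k) (hd : ∀ k, d k ≤ lam) (hZ : Z = U' * rectDiag F d * V'ᴴ) :
    reTrace (Xᴴ * Z) ≤ lam * ∑ k, s k := by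
  -- Changing bases makes `X` diagonal, so only the diagonal entries of `A * rectDiag F d * B`
  -- matter. Each has real part at most `lam`, by AM–GM and the unit norms of the rows of `A` and
  -- columns of `B`.
  set A := Uᴴ * U' with hA
  set B := V'ᴴ * V with hB
  have hAu : A ∈ unitary (Matrix (Fin m) (Fin m) F) :=
    mul_mem (Unitary.star_mem hX.unitary_left) hU'
  have hBu : B ∈ unitary (Matrix (Fin n) (Fin n) F) :=
    mul_mem (Unitary.star_mem hV') hX.unitary_right
  have h₁ : reTrace (Xᴴ * Z) = reTrace ((rectDiag F s)ᴴ * (A * rectDiag F d * B)) := by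
    rw [hX.eq_mul, hZ, hA, hB, Matrix.conjTranspose_mul, Matrix.conjTranspose_mul,
      Matrix.conjTranspose_conjTranspose, Matrix.mul_assoc V, reTrace_mul_comm]
    simp only [Matrix.mul_assoc]
  rw [h₁, reTrace_conjTranspose_rectDiag_mul, Finset.mul_sum]
  refine Finset.sum_le_sum fun k _ => ?_
  rw [mul_comm lam]
  refine mul_le_mul_of_nonneg_left ?_ (hX.nonneg k)
  have hlam : 0 ≤ lam := (hd₀ k).trans (hd k)
  rw [mul_rectDiag_mul_apply, map_sum]
  have hrow : ∑ l : Fin (min m n), ‖A (diagRow k) (diagRow l)‖ ^ 2 ≤ 1 := by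
    rw [← sum_norm_sq_row_of_mem_unitary hAu (diagRow k)]
    rw [← Finset.sum_image (s := Finset.univ) (g := (diagRow : Fin (min m n) → Fin m))
      (f := fun i => ‖A (diagRow k) i‖ ^ 2) (fun _ _ _ _ h => Fin.castLE_injective _ h)]
    exact Finset.sum_le_sum_of_subset_of_nonneg (Finset.subset_univ _) fun _ _ _ => by positivity
  have hcol : ∑ l : Fin (min m n), ‖B (diagCol l) (diagCol k)‖ ^ 2 ≤ 1 := by
    rw [← sum_norm_sq_col_of_mem_unitary hBu (diagCol k)]
    rw [← Finset.sum_image (s := Finset.univ) (g := (diagCol : Fin (min m n) → Fin n))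
      (f := fun i => ‖B i (diagCol k)‖ ^ 2) (fun _ _ _ _ h => Fin.castLE_injective _ h)]
    exact Finset.sum_le_sum_of_subset_of_nonneg (Finset.subset_univ _) fun _ _ _ => by positivity
  calc ∑ l, re (d l • (A (diagRow k) (diagRow l) * B (diagCol l) (diagCol k)))
      ≤ ∑ l, lam * ((‖A (diagRow k) (diagRow l)‖ ^ 2 + ‖B (diagCol l) (diagCol k)‖ ^ 2) / 2) := by
        refine Finset.sum_le_sum fun l _ => ?_
        rw [map_smul, smul_eq_mul]
        set a := A (diagRow k) (diagRow l)
        set b := B (diagCol l) (diagCol k)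
        have hab : re (a * b) ≤ (‖a‖ ^ 2 + ‖b‖ ^ 2) / 2 := by
          have := (le_abs_self _).trans ((abs_re_le_norm (a * b)).trans (norm_mul_le a b))
          nlinarith [sq_nonneg (‖a‖ - ‖b‖)]
        exact (mul_le_mul_of_nonneg_left hab (hd₀ l)).trans
          (mul_le_mul_of_nonneg_right (hd l) (by positivity))
    _ ≤ lam * 1 := by
        rw [← Finset.mul_sum, ← Finset.sum_div, Finset.sum_add_distrib]
        exact mul_le_mul_of_nonneg_left (by linarith) hlam
    _ = lam := mul_one _

theorem reTrace_unitary_mul_rectDiag {U : Matrix (Fin m) (Fin m) F} {V : Matrix (Fin n) (Fin n) F}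
    (hU : U ∈ unitary (Matrix (Fin m) (Fin m) F)) (hV : V ∈ unitary (Matrix (Fin n) (Fin n) F))
    (s t : Fin (min m n) → ℝ) :
    reTrace ((U * rectDiag F s * Vᴴ)ᴴ * (U * rectDiag F t * Vᴴ)) = ∑ k, s k * t k := by
  have h : (U * rectDiag F s * Vᴴ)ᴴ * (U * rectDiag F t * Vᴴ) =
      V * ((rectDiag F s)ᴴ * rectDiag F t * Vᴴ) := by
    simp only [Matrix.conjTranspose_mul, Matrix.conjTranspose_conjTranspose, Matrix.mul_assoc]
    rw [← Matrix.mul_assoc Uᴴ, ← Matrix.star_eq_conjTranspose U, Unitary.star_mul_self_of_mem hU,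
      Matrix.one_mul]
  rw [h, reTrace_mul_comm, Matrix.mul_assoc, ← Matrix.star_eq_conjTranspose V,
    Unitary.star_mul_self_of_mem hV, Matrix.mul_one, reTrace_conjTranspose_rectDiag_mul]
  simp only [rectDiag_apply_diag, re_algebraMap]

/-- Quadratic growth of the proximal objective around the soft-thresholded matrix. -/
theorem IsSVD.objective_softThreshold_le {N : Matrix (Fin m) (Fin n) F → ℝ} {lam : ℝ}
    (hlam : 0 ≤ lam) (hN : ∀ X U s V, IsSVD X U s V → N X = ∑ k, s k)
    {X Z : Matrix (Fin m) (Fin n) F} {U U' : Matrix (Fin m) (Fin m) F}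
    {V V' : Matrix (Fin n) (Fin n) F} {s s' : Fin (min m n) → ℝ}
    (hZ : IsSVD Z U s V) (hX : IsSVD X U' s' V') :
    1 / 2 * ‖vecL2 Z - vecL2 (U * rectDiag F (fun i => max (s i - lam) 0) * Vᴴ)‖ ^ 2 +
        lam * N (U * rectDiag F (fun i => max (s i - lam) 0) * Vᴴ) +
        1 / 2 * ‖vecL2 X - vecL2 (U * rectDiag F (fun i => max (s i - lam) 0) * Vᴴ)‖ ^ 2 ≤
      1 / 2 * ‖vecL2 Z - vecL2 X‖ ^ 2 + lam * N X := by
  set t : Fin (min m n) → ℝ := fun i => max (s i - lam) 0 with ht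
  set P := U * rectDiag F t * Vᴴ with hP
  have hvec : ∀ A B : Matrix (Fin m) (Fin n) F, vecL2 A - vecL2 B = vecL2 (A - B) := fun _ _ => rfl
  set D := Z - P with hD
  have hDeq : D = U * rectDiag F (fun k => s k - t k) * Vᴴ := by
    rw [hD, hP, hZ.eq_mul, rectDiag_sub, Matrix.mul_sub, Matrix.sub_mul]
  have hPS : IsSVD P U t V := hZ.softThreshold
  have h₁ : reTrace (Xᴴ * D) ≤ lam * N X := by
    rw [hN X _ _ _ hX]
    refine reTrace_conjTranspose_mul_le hX hZ.unitary_left hZ.unitary_right ?_ ?_ hDeq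
    · intro k
      have := hZ.nonneg k
      exact sub_nonneg.2 (max_le (by linarith) this)
    · intro k
      have := le_max_left (s k - lam) 0
      simp only [ht]
      linarith
  -- Complementary slackness: for each `k`, either `t k = 0` or `s k - t k = lam`.
  have h₂ : reTrace (Pᴴ * D) = lam * N P := by
    rw [hN P _ _ _ hPS, hDeq, hP, reTrace_unitary_mul_rectDiag hZ.unitary_left hZ.unitary_right,
      Finset.mul_sum]
    refine Finset.sum_congr rfl fun k _ => ?_
    simp only [ht]
    rcases le_total (s k - lam) 0 with h | h
    · rw [max_eq_right h]; ring
    · rw [max_eq_left h]; ring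
  have h₃ : reTrace ((Z - X)ᴴ * (Z - X)) = reTrace (Dᴴ * D) + reTrace ((X - P)ᴴ * (X - P)) -
      2 * (reTrace (Xᴴ * D) - reTrace (Pᴴ * D)) := by
    clear_value D
    have e : Z - X = D - (X - P) := by rw [hD]; abel
    rw [e]
    generalize hE : X - P = E
    have e₂ : reTrace (Dᴴ * E) = reTrace (Eᴴ * D) := by
      rw [← reTrace_conjTranspose, Matrix.conjTranspose_mul, Matrix.conjTranspose_conjTranspose]
    have e₃ : reTrace (Eᴴ * D) = reTrace (Xᴴ * D) - reTrace (Pᴴ * D) := by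
      rw [← hE, Matrix.conjTranspose_sub, Matrix.sub_mul, reTrace_sub]
    rw [Matrix.conjTranspose_sub, Matrix.sub_mul, Matrix.mul_sub, Matrix.mul_sub, reTrace_sub,
      reTrace_sub, reTrace_sub, e₂, e₃]
    ring
  rw [hvec, hvec, hvec, norm_vecL2_sq, norm_vecL2_sq, norm_vecL2_sq, h₃]
  linarith

/-- Singular value thresholding. -/
theorem IsSVD.prox_eq {N : Matrix (Fin m) (Fin n) F → ℝ} {lam : ℝ} (hlam : 0 ≤ lam)
    (hN : ∀ X U s V, IsSVD X U s V → N X = ∑ k, s k)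
    (hex : ∀ X : Matrix (Fin m) (Fin n) F, ∃ U s V, IsSVD X U s V)
    {Z : Matrix (Fin m) (Fin n) F} {U : Matrix (Fin m) (Fin m) F}
    {V : Matrix (Fin n) (Fin n) F} {s : Fin (min m n) → ℝ} (hZ : IsSVD Z U s V) :
    prox (fun x => lam * N (unvecL2 x)) (vecL2 Z) =
      {vecL2 (U * rectDiag F (fun i => max (s i - lam) 0) * Vᴴ)} := by
  have key : ∀ x : PiLp 2 (fun _ : Fin n × Fin m => F), _ := fun x =>
    let ⟨_, _, _, hX⟩ := hex (unvecL2 x)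
    hZ.objective_softThreshold_le hlam hN hX
  have hvu : ∀ x : PiLp 2 (fun _ : Fin n × Fin m => F), vecL2 (unvecL2 x) = x := fun _ => rfl
  have huv : ∀ X : Matrix (Fin m) (Fin n) F, unvecL2 (vecL2 X) = X := fun _ => rfl
  simp only [hvu] at key
  ext x
  simp only [prox, Set.mem_ofPred_eq, Set.mem_singleton_iff]
  constructor
  · intro hx
    have h₁ := isMinOn_univ_iff.1 hx (vecL2 (U * rectDiag F (fun i => max (s i - lam) 0) * Vᴴ))
    rw [huv] at h₁
    have h₂ := key x
    -- Quadratic growth leaves a second minimizer no room: the excess `½‖x - P‖²` must vanish.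
    have h₃ : ‖x - vecL2 (U * rectDiag F (fun i => max (s i - lam) 0) * Vᴴ)‖ ^ 2 ≤ 0 := by
      linarith
    have h₄ := pow_eq_zero_iff two_ne_zero |>.1 (le_antisymm h₃ (sq_nonneg _))
    exact sub_eq_zero.1 (norm_eq_zero.1 h₄)
  · rintro rfl
    refine isMinOn_univ_iff.2 fun y => ?_
    rw [huv]
    refine le_trans ?_ (key y)
    exact le_add_of_nonneg_right (by positivity)

end Prox

/-! ### Identification of the diagonal with the singular values. -/

section SingularValues

/-- The singular values of a matrix can be read off from a unitary diagonalisation of its Gram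
matrix. -/
theorem singularValues_toEuclideanLin_eq {κ ι : Type*} [Fintype κ] [DecidableEq κ] [Fintype ι]
    [DecidableEq ι] {A : Matrix κ ι ℂ} {W : Matrix ι ι ℂ} {d : ι → ℝ} {N : ℕ} (e : Fin N ≃ ι)
    (hW : Wᴴ * W = 1) (hd : ∀ i, 0 ≤ d i) (hanti : Antitone (d ∘ e))
    (hA : Aᴴ * A = W * Matrix.diagonal (fun i => ((d i ^ 2 : ℝ) : ℂ)) * Wᴴ) (k : Fin N) :
    (Matrix.toEuclideanLin A).singularValues k = d (e k) := by
  set T := Matrix.toEuclideanLin A with hT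
  have hN : Module.finrank ℂ (EuclideanSpace ℂ ι) = N := by
    rw [finrank_euclideanSpace, ← Fintype.card_congr e, Fintype.card_fin]
  have hTT : LinearMap.adjoint T ∘ₗ T = Matrix.toEuclideanLin (Aᴴ * A) := by
    rw [hT, ← Matrix.toEuclideanLin_conjTranspose_eq_adjoint]
    ext x i
    simp [Matrix.toLpLin_apply, Matrix.mulVec_mulVec]
  -- Cycling `W` around, by `charpoly (A * B) = charpoly (B * A)`, cancels it against `Wᴴ`.
  have hchar : (LinearMap.adjoint T ∘ₗ T).charpoly =
      ∏ i, (Polynomial.X - Polynomial.C (((d i ^ 2 : ℝ) : ℂ))) := by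
    rw [hTT, Matrix.toEuclideanLin_eq_toLin_orthonormal, Matrix.charpoly_toLin, hA,
      Matrix.charpoly_mul_comm, ← Matrix.mul_assoc, hW, Matrix.one_mul, Matrix.charpoly_diagonal]
  have hroots : (LinearMap.adjoint T ∘ₗ T).charpoly.roots.map RCLike.re =
      (List.ofFn fun k => d (e k) ^ 2 : Multiset ℝ) := by
    rw [hchar, Polynomial.roots_prod _ _
      (Finset.prod_ne_zero_iff.2 fun i _ => Polynomial.X_sub_C_ne_zero _)]
    simp only [Polynomial.roots_X_sub_C, Multiset.bind_singleton, Multiset.map_map,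
      Function.comp_apply, RCLike.re_to_complex, Complex.ofReal_re]
    rw [← Fin.univ_val_map, ← Finset.map_univ_equiv e, Finset.map_val, Multiset.map_map]
    rfl
  -- The eigenvalues are the sorted roots; the squares `d (e k) ^ 2` are already in nonincreasing
  -- order, so sorting leaves them in place.
  have hsort := T.isSymmetric_adjoint_comp_self.sort_roots_charpoly_eq_eigenvalues hN
  have hsorted : (List.ofFn fun k => d (e k) ^ 2).SortedGE :=
    List.sortedGE_ofFn_iff.2 fun a b h => pow_le_pow_left₀ (hd _) (hanti h) 2
  rw [hroots, Multiset.coe_sort, List.mergeSort_eq_self _ hsorted.pairwise, List.ofFn_inj] at hsort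
  rw [LinearMap.singularValues_fin T hN, ← hsort, Real.sqrt_sq (hd _)]

theorem extendZero_nonneg {r : ℕ} {s : Fin r → ℝ} (hs : ∀ k, 0 ≤ s k) (i : ℕ) :
    0 ≤ extendZero s i := by
  unfold extendZero
  split_ifs
  exacts [hs _, le_rfl]

theorem extendZero_antitone {r : ℕ} {s : Fin r → ℝ} (hs : ∀ k, 0 ≤ s k) (hanti : Antitone s) :
    Antitone (extendZero s) := by
  intro i j hij
  unfold extendZero
  split_ifs with h₁ h₂ h₂
  · exact hanti (by exact hij)
  · omega
  · exact hs _
  · exact le_rfl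

theorem extendZero_val {r : ℕ} (s : Fin r → ℝ) (k : Fin r) : extendZero s k = s k := by
  simp [extendZero]

theorem IsSVD.conjTranspose_mul_self {F : Type*} [NormedRing F] [StarRing F] [NormedAlgebra ℝ F]
    [StarModule ℝ F] {m n : ℕ} {Z : Matrix (Fin m) (Fin n) F} {U : Matrix (Fin m) (Fin m) F}
    {V : Matrix (Fin n) (Fin n) F} {s : Fin (min m n) → ℝ} (h : IsSVD Z U s V) :
    Zᴴ * Z = V * Matrix.diagonal (fun j : Fin n => algebraMap ℝ F (extendZero s j ^ 2)) * Vᴴ := by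
  rw [h.eq_mul, ← conjTranspose_rectDiag_mul_rectDiag]
  simp only [Matrix.conjTranspose_mul, Matrix.conjTranspose_conjTranspose, Matrix.mul_assoc]
  rw [← Matrix.mul_assoc Uᴴ, ← Matrix.star_eq_conjTranspose U,
    Unitary.star_mul_self_of_mem h.unitary_left, Matrix.one_mul]

theorem IsSVD.eq_singularValueC {m n : ℕ} {Z : Matrix (Fin m) (Fin n) ℂ}
    {U : Matrix (Fin m) (Fin m) ℂ} {V : Matrix (Fin n) (Fin n) ℂ} {s : Fin (min m n) → ℝ}
    (h : IsSVD Z U s V) (i : Fin (min m n)) : s i = singularValueC Z i := by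
  have := singularValues_toEuclideanLin_eq (A := Z) (W := V) (d := fun j => extendZero s j)
    (Equiv.refl (Fin n)) (Unitary.star_mul_self_of_mem h.unitary_right)
    (fun _ => extendZero_nonneg h.nonneg _)
    (fun _ _ hij => extendZero_antitone h.nonneg h.antitone hij) h.conjTranspose_mul_self
    (diagCol i)
  refine Eq.trans ?_ this.symm
  exact (extendZero_val s i).symm

/-- Together with compatibility with `ᴴ`, this transports the diagonalisation of `Zᴴ * Z` to the
complex representation. -/
theorem complexRep_mul {l m n : ℕ} (A : Matrix (Fin l) (Fin m) (Quaternion ℝ))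
    (B : Matrix (Fin m) (Fin n) (Quaternion ℝ)) :
    complexRep (A * B) = complexRep A * complexRep B := by
  have hsum : ∀ (f : Fin m → Quaternion ℝ), (∑ j, f j).re = ∑ j, (f j).re ∧
      (∑ j, f j).imI = ∑ j, (f j).imI ∧ (∑ j, f j).imJ = ∑ j, (f j).imJ ∧
      (∑ j, f j).imK = ∑ j, (f j).imK := fun f =>
    ⟨map_sum (AddMonoidHom.mk' (fun a : Quaternion ℝ => a.re) fun _ _ => rfl) f _,
      map_sum (AddMonoidHom.mk' (fun a : Quaternion ℝ => a.imI) fun _ _ => rfl) f _,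
      map_sum (AddMonoidHom.mk' (fun a : Quaternion ℝ => a.imJ) fun _ _ => rfl) f _,
      map_sum (AddMonoidHom.mk' (fun a : Quaternion ℝ => a.imK) fun _ _ => rfl) f _⟩
  unfold complexRep
  rw [Matrix.fromBlocks_multiply]
  ext (i | i) (k | k) <;> apply Complex.ext <;>
    simp only [Matrix.fromBlocks_apply₁₁, Matrix.fromBlocks_apply₁₂, Matrix.fromBlocks_apply₂₁,
      Matrix.fromBlocks_apply₂₂, Matrix.add_apply, Matrix.neg_apply, Matrix.map_apply,
      Matrix.mul_apply, hsum, Complex.add_re, Complex.add_im, Complex.neg_re, Complex.neg_im,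
      Complex.re_sum, Complex.im_sum, Complex.mul_re, Complex.mul_im, Complex.star_def,
      Complex.conj_re, Complex.conj_im, Quaternion.re_mul, Quaternion.imI_mul, Quaternion.imJ_mul,
      Quaternion.imK_mul, ← Finset.sum_add_distrib, ← Finset.sum_neg_distrib] <;>
    refine Finset.sum_congr rfl fun j _ => ?_ <;> ring

theorem complexRep_conjTranspose {m n : ℕ} (A : Matrix (Fin m) (Fin n) (Quaternion ℝ)) :
    complexRep Aᴴ = (complexRep A)ᴴ := by
  unfold complexRep
  rw [Matrix.fromBlocks_conjTranspose]
  ext (i | i) (k | k) <;> apply Complex.ext <;> simp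

theorem complexRep_diagonal {n : ℕ} (d : Fin n → ℝ) :
    complexRep (Matrix.diagonal fun j => algebraMap ℝ (Quaternion ℝ) (d j)) =
      Matrix.diagonal fun j => ((Sum.elim d d j : ℝ) : ℂ) := by
  unfold complexRep
  ext (i | i) (j | j) <;> rcases eq_or_ne i j with rfl | h <;> apply Complex.ext <;>
    simp [*] <;> rfl

theorem complexRep_one {n : ℕ} : complexRep (1 : Matrix (Fin n) (Fin n) (Quaternion ℝ)) = 1 := by
  have h := complexRep_diagonal fun _ : Fin n => 1
  have h' : (fun j : Fin n ⊕ Fin n =>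
      ((Sum.elim (fun _ : Fin n => (1 : ℝ)) (fun _ => 1) j : ℝ) : ℂ)) = fun _ => 1 := by
    ext (j | j) <;> simp
  rw [h'] at h
  simpa using h

/-- The indices `2 * i` and `2 * i + 1` in the first and in the second summand. -/
def interleave (n : ℕ) : Fin (n * 2) ≃ Fin n ⊕ Fin n :=
  finProdFinEquiv.symm.trans <| (Equiv.prodComm _ _).trans <|
    (finTwoEquiv.prodCongr (Equiv.refl _)).trans (Equiv.boolProdEquivSum _)

theorem elim_interleave {n : ℕ} (d : ℕ → ℝ) (k : Fin (n * 2)) :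
    Sum.elim (fun j : Fin n => d j) (fun j : Fin n => d j) (interleave n k) = d ((k : ℕ) / 2) := by
  have h : ∀ p : Bool × Fin n, Sum.elim (fun j : Fin n => d j) (fun j : Fin n => d j)
      (Equiv.boolProdEquivSum _ p) = d p.2 := by
    rintro ⟨_ | _, j⟩ <;> rfl
  exact h _

instance : StarModule ℝ (Quaternion ℝ) :=
  ⟨fun r a => by rw [Quaternion.star_smul, star_trivial r]⟩

theorem IsSVD.eq_singularValueH {m n : ℕ} {Z : Matrix (Fin m) (Fin n) (Quaternion ℝ)}
    {U : Matrix (Fin m) (Fin m) (Quaternion ℝ)} {V : Matrix (Fin n) (Fin n) (Quaternion ℝ)}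
    {s : Fin (min m n) → ℝ} (h : IsSVD Z U s V) (i : Fin (min m n)) :
    s i = singularValueH Z i := by
  have hi : (i : ℕ) < n := i.isLt.trans_le (min_le_right m n)
  have hW : (complexRep V)ᴴ * complexRep V = 1 := by
    rw [← complexRep_conjTranspose, ← complexRep_mul, ← Matrix.star_eq_conjTranspose,
      Unitary.star_mul_self_of_mem h.unitary_right, complexRep_one]
  have hG := congrArg complexRep h.conjTranspose_mul_self
  rw [complexRep_mul, complexRep_mul, complexRep_mul, complexRep_conjTranspose,
    complexRep_conjTranspose, complexRep_diagonal] at hG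
  have := singularValues_toEuclideanLin_eq (A := complexRep Z) (W := complexRep V)
    (d := Sum.elim (fun j : Fin n => extendZero s j) (fun j : Fin n => extendZero s j))
    (interleave n) hW (by rintro (j | j) <;> exact extendZero_nonneg h.nonneg _)
    (fun a b hab => by
      simp only [Function.comp_apply, elim_interleave]
      exact extendZero_antitone h.nonneg h.antitone (Nat.div_le_div_right hab))
    (by
      rw [hG]
      congr 3
      ext (j | j) <;> rfl)
    -- The even position of the `i`-th pair: `elim_interleave` reads off the entry at `2 * i / 2 =
    -- i`.
    ⟨2 * i, by omega⟩
  rw [elim_interleave] at this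
  refine Eq.trans ?_ this.symm
  simp [extendZero_val]

end SingularValues

/-! ### The two scalar rings and the final assembly. -/

noncomputable instance : RealTracialAlgebra ℂ where
  re := Complex.reLm
  re_one := rfl
  re_mul_comm a b := by rw [mul_comm]
  re_star a := by simp
  star_mul_self a := by
    rw [Complex.star_def, mul_comm, Complex.mul_conj, Complex.normSq_eq_norm_sq]
    rfl

noncomputable instance : RealTracialAlgebra (Quaternion ℝ) where
  re :=
    { toFun := fun a => a.re
      map_add' := fun _ _ => rfl
      map_smul' := fun _ _ => rfl }
  re_one := rfl
  re_mul_comm a b := by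
    change (a * b).re = (b * a).re
    rw [Quaternion.re_mul, Quaternion.re_mul]
    ring
  re_star _ := Quaternion.re_star _
  star_mul_self a := by
    rw [Quaternion.star_mul_self, Quaternion.normSq_eq_norm_mul_self, sq]
    rfl

end QuatPCP

theorem mainTheorem1 (m n : ℕ) (lam : ℝ) (hlam : 0 ≤ lam) :
    (∀ Z : Matrix (Fin m) (Fin n) ℂ,
      (∃ U s V, QuatPCP.IsSVD Z U s V) ∧
      ∀ U s V, QuatPCP.IsSVD Z U s V →
        (∀ i, s i = QuatPCP.singularValueC Z i) ∧
        QuatPCP.prox (fun x => lam * QuatPCP.traceNormC (QuatPCP.unvecL2 x)) (QuatPCP.vecL2 Z) =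
          {QuatPCP.vecL2 (U * QuatPCP.rectDiag ℂ (fun i => max (s i - lam) 0) * Vᴴ)}) ∧
    (∀ Z : Matrix (Fin m) (Fin n) (Quaternion ℝ),
      (∃ U s V, QuatPCP.IsSVD Z U s V) ∧
      ∀ U s V, QuatPCP.IsSVD Z U s V →
        (∀ i, s i = QuatPCP.singularValueH Z i) ∧
        QuatPCP.prox (fun x => lam * QuatPCP.traceNormH (QuatPCP.unvecL2 x)) (QuatPCP.vecL2 Z) =
          {QuatPCP.vecL2
            (U * QuatPCP.rectDiag (Quaternion ℝ) (fun i => max (s i - lam) 0) * Vᴴ)}) := by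
  have : FiniteDimensional ℝ (Quaternion ℝ) :=
    inferInstanceAs (FiniteDimensional ℝ (QuaternionAlgebra ℝ (-1) 0 (-1)))
  exact ⟨fun Z => ⟨QuatPCP.exists_isSVD Z, fun _ _ _ h => ⟨h.eq_singularValueC,
      h.prox_eq hlam (fun _ _ _ _ hX => Finset.sum_congr rfl fun i _ => (hX.eq_singularValueC i).symm)
        QuatPCP.exists_isSVD⟩⟩,
    fun Z => ⟨QuatPCP.exists_isSVD Z, fun _ _ _ h => ⟨h.eq_singularValueH,
      h.prox_eq hlam (fun _ _ _ _ hX => Finset.sum_congr rfl fun i _ => (hX.eq_singularValueH i).symm)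
        QuatPCP.exists_isSVD⟩⟩⟩
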